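/- Let $R$ be a Noetherian integral domain with field of fractions $K$ and let $M$ be a finitely generated torsion-free $R$-module. Put $M_K=M\otimes_R K$, so that $M\subseteq M_K$, and for a ring $V$ with $R\subseteq V\subseteq K$ let $MV$ be the $V$-submodule of $M_K$ generated by $M$. An element $v\in M_K$ is integral over $M$ if $v\in MV$ for every discrete valuation ring $V$ with $R\subseteq V\subseteq K$ whose field of fractions is $K$. The module $M$ is integrally closed if it equals its integral closure, i.e. the set of all elements of $M_K$ that are integral over $M$. Let $(R,\mathfrak m)$ be a $2$-dimensional regular local ring and let $\widehat R$ be its $\mathfrak m$-adic completion. If $M$ is a finitely generated, integrally closed, torsion-free $R$-module, then $M\otimes_R\widehat R$ is a finitely generated, integrally closed, torsion-free $\widehat R$-module. -/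

import Mathlib

open scoped TensorProduct

namespace ModuleClosure

universe u v

/-- `V` is a discrete valuation ring of `K`: a subring of `K` which is a discrete valuation ring
with field of fractions `K`. -/
structure IsDVROf {K : Type u} [CommRing K] (V : Subring K) : Prop where
  isDomain : IsDomain V
  isDiscreteValuationRing : IsDiscreteValuationRing V
  isFractionRing : IsFractionRing V K

variable (R : Type u) [CommRing R] (M : Type v) [AddCommGroup M] [Module R M]

/-- `M_K = K ⊗[R] M`, where `K` is the fraction field of the domain `R`. -/
abbrev Generic : Type (max u v) := FractionRing R ⊗[R] M

/-- The canonical map `M → M_K`, which is injective for `M` torsion-free. -/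
noncomputable def toGeneric : M →ₗ[R] Generic R M :=
  TensorProduct.mk R (FractionRing R) M 1

/-- `MV`, the `V`-submodule of `M_K` generated by the image of `M`,
for a subring `V` of the fraction field `K`. -/
noncomputable def extend (V : Subring (FractionRing R)) : Submodule V (Generic R M) :=
  Submodule.span V (Set.range (toGeneric R M))

variable {R M} in
/-- `x ∈ M_K` is integral over `M` if `x ∈ MV` for every discrete valuation ring `V` of `K`
containing `R`. -/
def IsIntegralOver (x : Generic R M) : Prop :=
  ∀ V : Subring (FractionRing R), IsDVROf V → (algebraMap R (FractionRing R)).range ≤ V →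
    x ∈ extend R M V

/-- The integral closure of `M`: the set of all elements of `M_K` that are integral over `M`. -/
def integralClosure : Set (Generic R M) :=
  {x | IsIntegralOver x}

/-- `M` is integrally closed: `M`, identified with its image in `M_K`, is equal to its
integral closure. -/
def IsIntegrallyClosed : Prop :=
  Set.range (toGeneric R M) = integralClosure R M

end ModuleClosure

/-! Write `A` for the completion, `K'` for its fraction field, and let `v` be integral over `A ⊗ M`.
Every nonmaximal prime of `A` is principal, so its localization is a discrete valuation ring or a
field, and `v` lies in `A ⊗ M` locally there; hence a power of the maximal ideal multiplies `v` into
`A ⊗ M` (`IsIntegralOver.exists_maximalIdeal_pow_smul_mem_range`). Torsion killed by such a power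
does not change under completion, so `v` differs from some `f ∈ M_K` by an element of `A ⊗ M`
(`exists_sub_genericMap_mem_range`). This `f` is integral over `A ⊗ M`. Once it is integral over
`M`, it lies in `M`, and so `v` lies in `A ⊗ M`.

The descent of integrality (`isIntegralOver_of_genericMap`) does not extend a given `V` to `K'`. If
`f ∉ MV`, some functional `ψ` is `V`-valued on `M` with `c = ψ f ∉ V`. Then `R[c⁻¹, ψ(M)] ⊆ V`
misses `c`, so by faithful flatness `A[c⁻¹, ψ(M)]` misses `c` too. Krull's principal ideal theorem
and Krull-Akizuki give a discrete valuation ring over the latter ring that misses `c`, contradicting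
integrality over `A ⊗ M`.

The ring theory of `A` (Noetherian, a domain, nonmaximal primes principal) comes from one axiomatic
notion, `IsParameterPair`, which passes from `R` to `A`. -/

/-! ### Lengths and the Krull-Akizuki theorem -/

section Length

variable {B : Type*} [CommRing B]

/-- Lengths of cokernels are additive under composition of injective maps. -/
lemma Module.length_quotient_range_comp {L M N : Type*} [AddCommGroup L] [AddCommGroup M]
    [AddCommGroup N] [Module B L] [Module B M] [Module B N] (f : L →ₗ[B] M) (g : M →ₗ[B] N)
    (hg : Function.Injective g) :
    Module.length B (N ⧸ LinearMap.range (g ∘ₗ f)) =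
      Module.length B (M ⧸ LinearMap.range f) + Module.length B (N ⧸ LinearMap.range g) := by
  have hle : LinearMap.range f ≤ (LinearMap.range (g ∘ₗ f)).comap g := by
    rintro _ ⟨x, rfl⟩; exact ⟨x, rfl⟩
  have hle' : LinearMap.range (g ∘ₗ f) ≤ LinearMap.range g := by
    rintro _ ⟨x, rfl⟩; exact ⟨f x, rfl⟩
  refine Module.length_eq_add_of_exact (Submodule.mapQ _ _ g hle) (Submodule.factor hle') ?_ ?_ ?_
  · rw [← LinearMap.ker_eq_bot, LinearMap.ker_eq_bot']
    intro m hm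
    obtain ⟨m, rfl⟩ := Submodule.mkQ_surjective _ m
    simp only [Submodule.mkQ_apply, Submodule.mapQ_apply, Submodule.Quotient.mk_eq_zero] at hm ⊢
    obtain ⟨x, hx⟩ := hm
    exact ⟨x, hg hx⟩
  · exact Submodule.factor_surjective hle'
  · intro n
    obtain ⟨n, rfl⟩ := Submodule.mkQ_surjective _ n
    constructor
    · intro h
      obtain ⟨m, rfl⟩ := (Submodule.Quotient.mk_eq_zero (LinearMap.range g)).mp h
      exact ⟨Submodule.Quotient.mk m, rfl⟩
    · rintro ⟨m, hm⟩
      obtain ⟨m, rfl⟩ := Submodule.mkQ_surjective _ m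
      rw [← hm]
      simp

/-- In a one-dimensional Noetherian domain, the length of `𝔞 / b𝔞` for a nonzero ideal `𝔞`
does not depend on `𝔞`. -/
lemma Module.length_quotient_range_lsmul [IsDomain B] [IsNoetherianRing B] [Ring.KrullDimLE 1 B]
    {N : Type*} [AddCommGroup N] [Module B N] (f : N →ₗ[B] B) (hf : Function.Injective f)
    {n : N} (hn : f n ≠ 0) {b : B} (hb : b ≠ 0) :
    Module.length B (N ⧸ LinearMap.range (LinearMap.lsmul B N b)) =
      Module.length B (B ⧸ LinearMap.range (LinearMap.lsmul B B b)) := by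
  -- The cokernel of this one map has two length formulas, one per factorization. The common
  -- summand, the length of `B ⧸ range f`, cancels because it is finite: `range f` contains `f n ≠
  -- 0`.
  have hcomm : f ∘ₗ LinearMap.lsmul B N b = LinearMap.lsmul B B b ∘ₗ f := by
    ext x; simp
  have h1 := Module.length_quotient_range_comp (LinearMap.lsmul B N b) f hf
  have h2 := Module.length_quotient_range_comp f (LinearMap.lsmul B B b) (by
    intro x y hxy
    simpa [hb] using hxy)
  rw [hcomm, h2, add_comm] at h1
  have hfin : Module.length B (B ⧸ LinearMap.range f) ≠ ⊤ := by
    have h3 : Module.length B (B ⧸ Ideal.span {f n}) ≠ ⊤ := by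
      rw [Module.length_ne_top_iff]
      exact isFiniteLength_quotient_span_singleton B (mem_nonZeroDivisors_of_ne_zero hn)
    have hle : Ideal.span {f n} ≤ LinearMap.range f := by
      rw [Ideal.span_le, Set.singleton_subset_iff]
      exact ⟨n, rfl⟩
    exact ne_top_of_le_ne_top h3
      (Module.length_le_of_surjective (Submodule.factor hle) (Submodule.factor_surjective hle))
  exact (WithTop.add_right_cancel hfin h1).symm

/-- A module all of whose finitely generated submodules have length at most a finite bound
has finite length, hence is Noetherian. -/
lemma isNoetherian_of_forall_fg_length_le {X : Type*} [AddCommGroup X] [Module B X] {l : ℕ∞}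
    (hl : l ≠ ⊤) (h : ∀ N : Submodule B X, N.FG → Module.length B N ≤ l) : IsNoetherian B X := by
  lift l to ℕ using hl
  have hfg : ∀ x : X, ∀ N : Submodule B X, N.FG → (N ⊔ Submodule.span B {x}).FG :=
    fun x N hN => hN.sup (Submodule.fg_span_singleton x)
  -- Among finitely generated submodules take `N` of maximal length; adjoining any further element
  -- would increase the length, so `N` is everything.
  obtain ⟨n, ⟨N, hN, hNn⟩, hmax⟩ : ∃ n : ℕ, (∃ N : Submodule B X, N.FG ∧ Module.length B N = n) ∧
      ∀ m : ℕ, (∃ N : Submodule B X, N.FG ∧ Module.length B N = m) → m ≤ n := by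
    have hb : ∀ m : ℕ, (∃ N : Submodule B X, N.FG ∧ Module.length B N = m) → m ≤ l := by
      rintro m ⟨N, hN, hNm⟩
      have := h N hN
      rw [hNm] at this
      exact_mod_cast this
    have hne : ∃ m : ℕ, ∃ N : Submodule B X, N.FG ∧ Module.length B N = m :=
      ⟨0, ⊥, Submodule.fg_bot, by simp⟩
    classical
    obtain ⟨m, hm⟩ := hne
    refine ⟨_, Nat.findGreatest_spec (P := fun m => ∃ N : Submodule B X, N.FG ∧
      Module.length B N = m) (hb m hm) hm, fun k hk => Nat.le_findGreatest (hb k hk) hk⟩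
  have htop : N = ⊤ := by
    rw [eq_top_iff]
    intro x _
    set N' := N ⊔ Submodule.span B {x} with hN'
    have hle := h N' (hfg x N hN)
    obtain ⟨m, hm⟩ := ENat.ne_top_iff_exists.mp (ne_top_of_le_ne_top (ENat.natCast_ne_top l) hle)
    have hmn := hmax m ⟨N', hfg x N hN, hm.symm⟩
    have hfin : IsFiniteLength B N' := by
      rw [← Module.length_ne_top_iff, ← hm]
      exact ENat.natCast_ne_top m
    obtain ⟨_, _⟩ := isFiniteLength_iff_isNoetherian_isArtinian.mp hfin
    by_contra hx
    have hlt : N.submoduleOf N' ≠ ⊤ := by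
      intro htop
      have : (⟨x, Submodule.mem_sup_right (Submodule.mem_span_singleton_self x)⟩ : N') ∈
        N.submoduleOf N' := by rw [htop]; trivial
      exact hx this
    have := Submodule.length_lt hlt
    rw [(Submodule.submoduleOfEquivOfLe (le_sup_left : N ≤ N')).length_eq, hNn, ← hm] at this
    exact absurd hmn (not_le.mpr (by exact_mod_cast this))
  have hfin : IsFiniteLength B N := by
    rw [← Module.length_ne_top_iff, hNn]
    exact ENat.natCast_ne_top n
  obtain ⟨h1, _⟩ := isFiniteLength_iff_isNoetherian_isArtinian.mp hfin
  subst htop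
  exact (isNoetherian_top_iff).mp h1

/-- The **Krull-Akizuki theorem** for rings between a domain and its field of fractions. -/
theorem isNoetherianRing_subring_of_krullDimLE_one [IsDomain B] [IsNoetherianRing B]
    [Ring.KrullDimLE 1 B] {K : Type*} [Field K] [Algebra B K] [IsFractionRing B K] (W : Subring K)
    (hW : (algebraMap B K).range ≤ W) : IsNoetherianRing W := by
  let φ : B →+* W := (algebraMap B K).codRestrict W fun b => hW ⟨b, rfl⟩
  let _ : Algebra B W := φ.toAlgebra
  have : IsScalarTower B W K := IsScalarTower.of_algebraMap_eq fun _ => rfl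
  have hφ : ∀ b : B, ((algebraMap B W b : W) : K) = algebraMap B K b := fun _ => rfl
  have hinj : Function.Injective (algebraMap B K) := IsFractionRing.injective B K
  refine ⟨fun J => ?_⟩
  rcases eq_or_ne J ⊥ with rfl | hJ
  · exact Submodule.fg_bot
  obtain ⟨w, hwJ, hw0⟩ := Submodule.exists_mem_ne_zero_of_ne_bot hJ
  -- The numerator `a` is a nonzero element of `B` in `J`, so it suffices that `W ⧸ aW` is
  -- Noetherian over `B`.
  obtain ⟨a, c, hc, hac⟩ := IsFractionRing.div_surjective (A := B) (w : K)
  have hc0 : algebraMap B K c ≠ 0 := by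
    simpa using (nonZeroDivisors.ne_zero hc)
  have hwK : (w : K) ≠ 0 := by simpa using hw0
  have haw : algebraMap B W a = w * algebraMap B W c := by
    apply Subtype.ext
    rw [Subring.coe_mul, hφ, hφ, ← hac, div_mul_cancel₀ _ hc0]
  have haJ : algebraMap B W a ∈ J := haw ▸ Ideal.mul_mem_right _ J hwJ
  have ha0 : a ≠ 0 := by
    rintro rfl
    apply hwK
    rw [← hac]; simp
  let I : Ideal W := Ideal.span {algebraMap B W a}
  let π : W →ₗ[B] W ⧸ I := (Submodule.mkQ I).restrictScalars B
  have hπ : Function.Surjective π := Submodule.mkQ_surjective I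
  have hX : IsNoetherian B (W ⧸ I) := by
    refine isNoetherian_of_forall_fg_length_le
      (l := Module.length B (B ⧸ LinearMap.range (LinearMap.lsmul B B a))) ?_ ?_
    · rw [Module.length_ne_top_iff]
      have : LinearMap.range (LinearMap.lsmul B B a) = Ideal.span {a} := by
        ext x
        simp [Ideal.mem_span_singleton', mul_comm]
      rw [this]
      exact isFiniteLength_quotient_span_singleton B (mem_nonZeroDivisors_of_ne_zero ha0)
    · rintro N ⟨s, rfl⟩
      classical
      -- Including `1` guarantees that `N'` is nonzero. A common denominator `d` of `t` then embeds
      -- `N'` in `B` as a nonzero ideal, so `N' ⧸ aN'` has the length of `B ⧸ aB`.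
      let t : Finset W := insert 1 (s.image (Function.surjInv hπ))
      let N' : Submodule B W := Submodule.span B t
      have hle : Submodule.span B (s : Set (W ⧸ I)) ≤ N'.map π := by
        rw [Submodule.span_le]
        intro x hx
        refine ⟨Function.surjInv hπ x, Submodule.subset_span ?_, Function.surjInv_eq hπ x⟩
        simp only [t, Finset.coe_insert, Finset.coe_image]
        exact Or.inr ⟨x, hx, rfl⟩
      obtain ⟨d, hd⟩ := IsLocalization.exist_integer_multiples_of_finset (nonZeroDivisors B)
        (t.image (fun x : W => (x : K)))
      have hd0 : algebraMap B K (d : B) ≠ 0 := by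
        simp
      let g : N' →ₗ[B] K := (LinearMap.lsmul B K (d : B)) ∘ₗ
        (Algebra.linearMap W K).restrictScalars B ∘ₗ N'.subtype
      have hg : ∀ x : N', g x = algebraMap B K d * ((x : W) : K) := fun x => by
        simp only [g, LinearMap.comp_apply, LinearMap.lsmul_apply, Algebra.smul_def]
        rfl
      have hgr : ∀ x : N', g x ∈ LinearMap.range (Algebra.linearMap B K) := by
        rintro ⟨x, hx⟩
        rw [hg]
        show algebraMap B K d * (x : K) ∈ _
        induction hx using Submodule.span_induction with
        | mem x hx =>
          obtain ⟨b, hb⟩ := hd x (Finset.mem_image_of_mem _ hx)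
          exact ⟨b, by rw [Algebra.linearMap_apply, hb, Algebra.smul_def]⟩
        | zero => simp
        | add x y _ _ hx hy => rw [Subring.coe_add, mul_add]; exact add_mem hx hy
        | smul b x _ hx =>
          have : ((b • x : W) : K) = b • (x : K) := by
            rw [Algebra.smul_def, Algebra.smul_def]; rfl
          rw [this, mul_smul_comm]
          exact Submodule.smul_mem _ _ hx
      let f : N' →ₗ[B] B :=
        (LinearEquiv.ofInjective (Algebra.linearMap B K) hinj).symm.toLinearMap ∘ₗ
          g.codRestrict _ hgr
      have hginj : Function.Injective g := by
        intro x y hxy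
        rw [hg, hg] at hxy
        exact Subtype.ext (Subtype.ext (mul_left_cancel₀ hd0 hxy))
      have hf : Function.Injective f := by
        rw [LinearMap.coe_comp]
        refine (LinearEquiv.injective _).comp fun x y hxy => hginj ?_
        exact congrArg Subtype.val hxy
      have h1 : (1 : W) ∈ N' := Submodule.subset_span (by simp [t])
      have hf1 : f ⟨1, h1⟩ ≠ 0 := by
        rw [Ne, ← map_zero f, hf.eq_iff, Subtype.ext_iff]
        exact one_ne_zero
      rw [← Module.length_quotient_range_lsmul f hf hf1 ha0]
      refine (Module.length_le_of_injective (Submodule.inclusion hle)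
        (Submodule.inclusion_injective hle)).trans ?_
      have hle' : LinearMap.range (LinearMap.lsmul B N' a) ≤ LinearMap.ker (π.submoduleMap N') := by
        rintro _ ⟨x, rfl⟩
        rw [LinearMap.mem_ker]
        apply Subtype.ext
        show (Submodule.Quotient.mk ((a • x : N') : W) : W ⧸ I) = 0
        rw [Submodule.Quotient.mk_eq_zero, Submodule.coe_smul, Algebra.smul_def]
        exact I.mul_mem_right _ (Ideal.mem_span_singleton_self _)
      refine Module.length_le_of_surjective (Submodule.liftQ _ (π.submoduleMap N') hle') ?_
      intro y
      obtain ⟨x, rfl⟩ := LinearMap.submoduleMap_surjective π N' y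
      exact ⟨Submodule.Quotient.mk x, rfl⟩
  have hX' : IsNoetherian W (W ⧸ I) := isNoetherian_of_tower B hX
  have hIJ : I ≤ J := by
    rw [Ideal.span_le, Set.singleton_subset_iff]; exact haJ
  refine Submodule.fg_of_fg_map_of_fg_inf_ker I.mkQ (IsNoetherian.noetherian _) ?_
  rw [Submodule.ker_mkQ, inf_eq_right.mpr hIJ]
  exact Submodule.fg_span_singleton _

end Length

namespace ModuleClosure

/-! ### Existence of discrete valuation rings -/

section ExistsDVR

universe u
variable {K : Type u} [Field K]

open IsLocalRing in
/-- A nonunit of a Noetherian ring `T` with field of fractions `K` is a nonunit in some discrete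
valuation ring of `K` containing `T`. -/
theorem exists_isDVROf_inv_notMem (T : Subring K) [IsNoetherianRing T] [IsFractionRing T K]
    {g : K} (hg : g ∈ T) (hg0 : g ≠ 0) (hginv : g⁻¹ ∉ T) :
    ∃ W : Subring K, IsDVROf W ∧ T ≤ W ∧ g⁻¹ ∉ W := by
  have hne : Ideal.span {(⟨g, hg⟩ : T)} ≠ ⊤ := by
    intro h
    obtain ⟨c, hc⟩ := (Ideal.span_singleton_eq_top.mp h).exists_right_inv
    have : g * (c : K) = 1 := congrArg Subtype.val hc
    exact hginv (eq_inv_of_mul_eq_one_right this ▸ c.2)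
  obtain ⟨P, hP⟩ := Ideal.nonempty_minimalPrimes hne
  have := hP.1.1
  have hgP : (⟨g, hg⟩ : T) ∈ P := hP.1.2 (Ideal.mem_span_singleton_self _)
  have hht := Ideal.height_le_one_of_isPrincipal_of_mem_minimalPrimes _ P hP
  let L := LocalSubring.ofPrime T P
  have hTL : T ≤ L.toSubring := LocalSubring.le_ofPrime T P
  have : IsLocalization.AtPrime L.toSubring P := inferInstanceAs
    (IsLocalization.AtPrime (LocalSubring.ofPrime T P).toSubring P)
  have : IsScalarTower T L.toSubring K := inferInstanceAs
    (IsScalarTower T (LocalSubring.ofPrime T P).toSubring K)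
  have : IsNoetherianRing L.toSubring := IsLocalization.isNoetherianRing P.primeCompl _ ‹_›
  have : IsFractionRing L.toSubring K :=
    IsFractionRing.isFractionRing_of_isDomain_of_isLocalization P.primeCompl L.toSubring K
  have : Ring.KrullDimLE 1 L.toSubring := by
    rw [Ring.krullDimLE_iff, IsLocalization.AtPrime.ringKrullDim_eq_height P L.toSubring]
    exact_mod_cast hht
  have hgL : (⟨g, hTL hg⟩ : L.toSubring) ∈ maximalIdeal L.toSubring :=
    (IsLocalization.AtPrime.to_map_mem_maximal_iff L.toSubring P ⟨g, hg⟩).mpr hgP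
  -- `L` has dimension at most one, so Krull-Akizuki makes any dominating valuation ring Noetherian;
  -- domination keeps `g` a nonunit.
  obtain ⟨W, hLW, hloc⟩ := L.exists_le_valuationSubring
  have hgW : g ∈ W := hLW (hTL hg)
  have hgm : ¬ IsUnit (⟨g, hgW⟩ : W) := fun h =>
    (mem_maximalIdeal _).mp hgL (hloc.map_nonunit ⟨g, hTL hg⟩ h)
  have hN : IsNoetherianRing W := 
    isNoetherianRing_subring_of_krullDimLE_one (B := L.toSubring) W.toSubring <| by
      rintro _ ⟨x, rfl⟩
      exact hLW x.2
  have hfield : ¬ IsField W := by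
    intro h
    obtain ⟨c, hc⟩ := h.mul_inv_cancel (a := (⟨g, hgW⟩ : W)) (fun h => hg0 (congrArg Subtype.val h))
    exact hgm (IsUnit.of_mul_eq_one _ hc)
  refine ⟨W.toSubring, ⟨inferInstanceAs (IsDomain W), ?_, inferInstanceAs (IsFractionRing W K)⟩,
    hTL.trans hLW, ?_⟩
  · have : ValuationRing W := inferInstance
    exact ((IsDiscreteValuationRing.TFAE W hfield).out 0 1).mpr this
  · intro h
    exact hgm (IsUnit.of_mul_eq_one ⟨g⁻¹, h⟩ (Subtype.ext (mul_inv_cancel₀ hg0)))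

/-- The localization of a Noetherian domain at a prime element is a discrete valuation ring. -/
theorem exists_isDVROf_of_prime {A : Type*} [CommRing A] [IsDomain A] [IsNoetherianRing A]
    [Algebra A K] [IsFractionRing A K] {f : A} (hf : Prime f) :
    ∃ W : Subring K, IsDVROf W ∧ (algebraMap A K).range ≤ W ∧
      ∀ x ∈ W, ∃ s ∉ Ideal.span {f}, ∃ a, algebraMap A K s * x = algebraMap A K a := by
  have hP : (Ideal.span {f}).IsPrime := (Ideal.span_singleton_prime hf.ne_zero).mpr hf
  set P := Ideal.span {f}
  have hS : P.primeCompl ≤ nonZeroDivisors A := P.primeCompl_le_nonZeroDivisors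
  let W := Localization.subalgebra.ofField K P.primeCompl hS
  have hloc : IsLocalization.AtPrime W P := inferInstanceAs
    (IsLocalization P.primeCompl (Localization.subalgebra.ofField K P.primeCompl hS))
  have : IsLocalRing W := IsLocalization.AtPrime.isLocalRing W P
  have : IsNoetherianRing W := IsLocalization.isNoetherianRing P.primeCompl _ ‹_›
  have hmax : IsLocalRing.maximalIdeal W = Ideal.span {algebraMap A W f} := by
    rw [← IsLocalization.AtPrime.map_eq_maximalIdeal P W, Ideal.map_span, Set.image_singleton]
  have hfield : ¬ IsField W := by
    rw [IsLocalRing.isField_iff_maximalIdeal_eq, hmax, Ideal.span_singleton_eq_bot]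
    rw [map_eq_zero_iff _ (FaithfulSMul.algebraMap_injective A W)]
    exact hf.ne_zero
  refine ⟨W.toSubring, ⟨inferInstanceAs (IsDomain W), ?_, inferInstanceAs (IsFractionRing W K)⟩,
    ?_, ?_⟩
  · have : (IsLocalRing.maximalIdeal W).IsPrincipal := ⟨_, hmax⟩
    exact ((IsDiscreteValuationRing.TFAE W hfield).out 0 4).mpr this
  · rintro _ ⟨a, rfl⟩
    exact W.algebraMap_mem a
  · rintro x ⟨a, s, hs, rfl⟩
    have : algebraMap A K s ≠ 0 := by
      rw [Ne, map_eq_zero_iff _ (IsFractionRing.injective A K)]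
      exact nonZeroDivisors.ne_zero (hS hs)
    exact ⟨s, hs, a, by field_simp⟩

end ExistsDVR

/-! ### Local rings with maximal ideal generated by two elements -/

section TwoGenerated

open IsLocalRing

lemma ideal_sup_pow_le {B : Type*} [CommRing B] (I J : Ideal B) (n : ℕ) :
    (I ⊔ J) ^ n ≤ I ⊔ J ^ n := by
  induction n with
  | zero => simp
  | succ n ih =>
    rw [pow_succ, pow_succ, Ideal.mul_le]
    intro r hr s hs
    obtain ⟨a, ha, b, hb, rfl⟩ := Submodule.mem_sup.mp (ih hr)
    obtain ⟨c, hc, d, hd, rfl⟩ := Submodule.mem_sup.mp hs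
    have : (a + b) * (c + d) = (a * (c + d) + b * c) + b * d := by ring
    rw [this]
    exact add_mem (Ideal.mem_sup_left (add_mem (I.mul_mem_right _ ha) (I.mul_mem_left _ hc)))
      (Ideal.mem_sup_right (Ideal.mul_mem_mul hb hd))

/-- A local ring whose maximal ideal is generated by two elements `x` and `y`, with `(x)` closed and
`y` not nilpotent modulo `x`, and for which Nakayama's lemma holds along `x`. -/
structure IsParameterPair {B : Type*} [CommRing B] [IsLocalRing B] (x y : B) : Prop where
  maximalIdeal_eq : maximalIdeal B = Ideal.span {x, y}
  mem_of_forall_mem : ∀ a, (∀ n, a ∈ Ideal.span {x} ⊔ maximalIdeal B ^ n) → a ∈ Ideal.span {x}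
  pow_notMem : ∀ n, y ^ n ∉ Ideal.span {x}
  le_span_of_forall : ∀ (P : Ideal B) (f : B), (∀ a ∈ P, ∃ b, ∃ c ∈ P, a = f * b + x * c) →
    P ≤ Ideal.span {f}

variable {B : Type*} [CommRing B] [IsLocalRing B] {x y : B}

namespace IsParameterPair

variable (h : IsParameterPair x y)
include h

/-- Modulo `x` the ring behaves like a discrete valuation ring with uniformizer `y`. Closedness of
`(x)` gives a largest `k` with `a ∈ (x) + 𝔪ᵏ = (x) + (yᵏ)`; a nonunit coefficient of `yᵏ` would put
`a` in `(x) + 𝔪ᵏ⁺¹`. -/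
lemma exists_eq_unit_mul_pow_add {a : B} (ha : a ∉ Ideal.span {x}) :
    ∃ (n : ℕ) (u c : B), IsUnit u ∧ a = u * y ^ n + x * c := by
  have hex : ∃ n, a ∉ Ideal.span {x} ⊔ maximalIdeal B ^ n := by
    by_contra! hcon
    exact ha (h.mem_of_forall_mem a hcon)
  classical
  obtain ⟨k, hk⟩ : ∃ k, Nat.find hex = k + 1 := by
    refine Nat.exists_eq_succ_of_ne_zero fun h0 => ?_
    have := Nat.find_spec hex
    rw [h0] at this
    simp at this
  have h1 := Nat.find_spec hex
  have h2 := not_not.mp (Nat.find_min hex (m := k) (by omega))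
  rw [hk] at h1
  have hle : Ideal.span {x} ⊔ maximalIdeal B ^ k ≤ Ideal.span {x} ⊔ Ideal.span {y ^ k} := by
    refine sup_le le_sup_left ?_
    rw [h.maximalIdeal_eq, Ideal.span_insert, ← Ideal.span_singleton_pow]
    exact ideal_sup_pow_le _ _ _
  obtain ⟨s, hs, t, ht, hst⟩ := Submodule.mem_sup.mp (hle h2)
  obtain ⟨c, rfl⟩ := Ideal.mem_span_singleton'.mp hs
  obtain ⟨u, rfl⟩ := Ideal.mem_span_singleton'.mp ht
  refine ⟨k, u, c, ?_, by rw [← hst]; ring⟩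
  by_contra hu
  have hum : u ∈ maximalIdeal B := hu
  have hy : y ∈ maximalIdeal B := by
    rw [h.maximalIdeal_eq]; exact Ideal.subset_span (by simp)
  apply h1
  rw [← hst, pow_succ']
  exact add_mem (Ideal.mem_sup_left hs)
    (Ideal.mem_sup_right (Ideal.mul_mem_mul hum (Ideal.pow_mem_pow hy k)))

lemma x_mem : x ∈ maximalIdeal B := by
  rw [h.maximalIdeal_eq]; exact Ideal.subset_span (by simp)

lemma isPrime_span : (Ideal.span {x}).IsPrime := by
  refine ⟨fun htop => h.pow_notMem 0 (htop ▸ Submodule.mem_top), ?_⟩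
  intro a b hab
  by_contra! hcon
  obtain ⟨n, u, c, hu, rfl⟩ := h.exists_eq_unit_mul_pow_add hcon.1
  obtain ⟨m, v, d, hv, rfl⟩ := h.exists_eq_unit_mul_pow_add hcon.2
  have h1 : u * v * y ^ (n + m) ∈ Ideal.span {x} := by
    have : u * v * y ^ (n + m) = (u * y ^ n + x * c) * (v * y ^ m + x * d)
        - x * (u * y ^ n * d + c * (v * y ^ m + x * d)) := by ring
    rw [this]
    exact sub_mem hab (Ideal.mul_mem_right _ _ (Ideal.mem_span_singleton_self x))
  exact h.pow_notMem _ ((Ideal.unit_mul_mem_iff_mem _ (hu.mul hv)).mp h1)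

/-- Every nonmaximal prime ideal is principal. -/
lemma exists_eq_span_singleton (P : Ideal B) [hP : P.IsPrime] (hPm : P ≠ maximalIdeal B) :
    ∃ f, P = Ideal.span {f} := by
  by_cases hPx : P ≤ Ideal.span {x}
  · by_cases hxP : x ∈ P
    · exact ⟨x, le_antisymm hPx ((Ideal.span_singleton_le_iff_mem _).mpr hxP)⟩
    -- Here `P ⊆ (x)` and `x ∉ P` give `P = xP`, so `P = 0` by the Nakayama condition.
    · refine ⟨0, le_antisymm (h.le_span_of_forall P 0 fun a ha => ?_) (by simp)⟩
      obtain ⟨c, rfl⟩ := Ideal.mem_span_singleton'.mp (hPx ha)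
      exact ⟨0, c, (hP.mem_or_mem ha).resolve_right hxP, by ring⟩
  · have hxP : x ∉ P := by
      intro hxP
      obtain ⟨a, haP, hax⟩ := SetLike.not_le_iff_exists.mp hPx
      obtain ⟨n, u, c, hu, rfl⟩ := h.exists_eq_unit_mul_pow_add hax
      have h1 : u * y ^ n ∈ P := (Ideal.add_mem_iff_left _ (P.mul_mem_right c hxP)).mp haP
      have h2 : y ∈ P := hP.mem_of_pow_mem n ((Ideal.unit_mul_mem_iff_mem _ hu).mp h1)
      apply hPm
      refine le_antisymm (le_maximalIdeal hP.ne_top) ?_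
      rw [h.maximalIdeal_eq, Ideal.span_le]
      rintro z (rfl | rfl)
      exacts [hxP, h2]
    obtain ⟨a, haP, hax⟩ := SetLike.not_le_iff_exists.mp hPx
    -- A generator is an element of `P` of least `y`-order modulo `x`: subtracting a multiple of it
    -- from `b ∈ P` leaves `x * c`, with `c ∈ P` since `x ∉ P`, and the Nakayama condition applies.
    have hex : ∃ n : ℕ, ∃ u c : B, IsUnit u ∧ u * y ^ n + x * c ∈ P := by
      obtain ⟨n, u, c, hu, rfl⟩ := h.exists_eq_unit_mul_pow_add hax
      exact ⟨n, u, c, hu, haP⟩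
    classical
    obtain ⟨u, c, hu, hf⟩ := Nat.find_spec hex
    set n := Nat.find hex with hn
    refine ⟨u * y ^ n + x * c, le_antisymm (h.le_span_of_forall P _ fun b hb => ?_)
      ((Ideal.span_singleton_le_iff_mem _).mpr hf)⟩
    by_cases hbx : b ∈ Ideal.span {x}
    · obtain ⟨d, rfl⟩ := Ideal.mem_span_singleton'.mp hbx
      exact ⟨0, d, (hP.mem_or_mem hb).resolve_right hxP, by ring⟩
    · obtain ⟨m, v, d, hv, rfl⟩ := h.exists_eq_unit_mul_pow_add hbx
      have hnm : n ≤ m := Nat.find_min' hex ⟨v, d, hv, hb⟩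
      obtain ⟨k, rfl⟩ := Nat.exists_eq_add_of_le hnm
      obtain ⟨u', hu'⟩ := hu.exists_right_inv
      have heq : v * y ^ (n + k) + x * d =
          (u * y ^ n + x * c) * (u' * v * y ^ k) + x * (d - c * (u' * v * y ^ k)) := by
        linear_combination (- v * y ^ (n + k)) * hu'
      refine ⟨u' * v * y ^ k, d - c * (u' * v * y ^ k), ?_, heq⟩
      have : x * (d - c * (u' * v * y ^ k)) ∈ P :=
        (Ideal.add_mem_iff_right _ (P.mul_mem_right _ hf)).mp (heq ▸ hb)
      exact (hP.mem_or_mem this).resolve_left hxP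

lemma isNoetherianRing : IsNoetherianRing B := by
  refine IsNoetherianRing.of_prime fun P hP => ?_
  by_cases hPm : P = maximalIdeal B
  · rw [hPm, h.maximalIdeal_eq]
    exact Submodule.fg_span (by simp)
  · obtain ⟨f, rfl⟩ := h.exists_eq_span_singleton P hPm
    exact Submodule.fg_span_singleton f

end IsParameterPair

/-- A Noetherian local ring with a nonminimal principal prime ideal is a domain. -/
lemma isDomain_of_lt_span_singleton [IsNoetherianRing B] {q : Ideal B} [hq : q.IsPrime] {f : B}
    (hf : (Ideal.span {f}).IsPrime) (hlt : q < Ideal.span {f}) : IsDomain B := by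
  have hfq : f ∉ q := fun h => hlt.not_ge ((Ideal.span_singleton_le_iff_mem _).mpr h)
  have hq0 : q = ⊥ := by
    refine Submodule.eq_bot_of_le_smul_of_le_jacobson_bot (Ideal.span {f}) q
      (IsNoetherian.noetherian q) (fun a ha => ?_) ?_
    · obtain ⟨c, rfl⟩ := Ideal.mem_span_singleton'.mp (hlt.le ha)
      rw [mul_comm]
      exact Submodule.smul_mem_smul (Ideal.mem_span_singleton_self f)
        ((hq.mem_or_mem ha).resolve_right hfq)
    · rw [IsLocalRing.jacobson_eq_maximalIdeal _ bot_ne_top]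
      exact le_maximalIdeal hf.ne_top
  subst hq0
  exact IsDomain.of_bot_isPrime B

/-- Closedness is Krull's intersection theorem in `B ⧸ (x)`; the last condition is Nakayama's lemma.
-/
lemma IsParameterPair.of_isNoetherianRing [IsNoetherianRing B]
    (hm : maximalIdeal B = Ideal.span {x, y}) (hy : ∀ n, y ^ n ∉ Ideal.span {x}) :
    IsParameterPair x y := by
  have hxm : x ∈ maximalIdeal B := by rw [hm]; exact Ideal.subset_span (by simp)
  refine ⟨hm, fun a ha => ?_, hy, fun P f hP => ?_⟩
  · have hH : IsHausdorff (maximalIdeal B) (B ⧸ Ideal.span {x}) := inferInstance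
    rw [← Ideal.Quotient.eq_zero_iff_mem]
    refine hH.haus _ fun n => ?_
    rw [SModEq.zero]
    obtain ⟨s, hs, t, ht, rfl⟩ := Submodule.mem_sup.mp (ha n)
    rw [map_add, Ideal.Quotient.eq_zero_iff_mem.mpr hs, zero_add]
    have : (Ideal.Quotient.mk (Ideal.span {x}) t) = t • (1 : B ⧸ Ideal.span {x}) := by
      rw [Algebra.smul_def, mul_one]; rfl
    rw [this]
    exact Submodule.smul_mem_smul ht Submodule.mem_top
  · refine Submodule.le_of_le_smul_of_le_jacobson_bot (I := Ideal.span {x})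
      (IsNoetherian.noetherian P) ?_ fun a ha => ?_
    · rw [IsLocalRing.jacobson_eq_maximalIdeal _ bot_ne_top]
      exact (Ideal.span_singleton_le_iff_mem _).mpr hxm
    · obtain ⟨b, c, hc, rfl⟩ := hP a ha
      exact add_mem (Ideal.mem_sup_left (Ideal.mul_mem_right _ _ (Ideal.mem_span_singleton_self f)))
        (Ideal.mem_sup_right (Submodule.smul_mem_smul (Ideal.mem_span_singleton_self x) hc))

/-- Iterating `a = f * b + x * c` expresses `a` as `f` times a convergent series in powers of `x`.
Completeness replaces finite generation of `P`, so this is usable before the ring is known to be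
Noetherian. -/
lemma le_span_singleton_of_isAdicComplete {B : Type*} [CommRing B] {x : B} {I : Ideal B}
    [IsAdicComplete I B] (hx : x ∈ I) (P : Ideal B) (f : B) (hP : ∀ a ∈ P, ∃ b, ∃ c ∈ P, a = f * b + x * c) :
    P ≤ Ideal.span {f} := by
  intro a ha
  choose! b c hc hbc using hP
  let s : ℕ → B := fun n => c^[n] a
  have hs : ∀ n, s n ∈ P := fun n => by
    induction n with
    | zero => exact ha
    | succ n ih =>
      simp only [s, Function.iterate_succ_apply']
      exact hc _ ih
  have hsucc : ∀ n, s n = f * b (s n) + x * s (n + 1) := fun n => by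
    have := hbc _ (hs n)
    simpa only [s, Function.iterate_succ_apply'] using this
  let t : ℕ → B := fun n => ∑ i ∈ Finset.range n, x ^ i * b (s i)
  have ht : ∀ n, a = f * t n + x ^ n * s n := fun n => by
    induction n with
    | zero => simp [t, s]
    | succ n ih =>
      have : t (n + 1) = t n + x ^ n * b (s n) := Finset.sum_range_succ _ _
      rw [this, pow_succ]
      linear_combination ih + x ^ n * hsucc n
  obtain ⟨L, hL⟩ := IsPrecomplete.prec' (I := I) t fun {m n} hmn => by
    rw [SModEq.sub_mem, ← neg_mem_iff, neg_sub, ← Finset.sum_Ico_eq_sub _ hmn, smul_eq_mul,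
      Ideal.mul_top]
    exact sum_mem fun i hi => Ideal.mul_mem_right _ _
      (Ideal.pow_le_pow_right (Finset.mem_Ico.mp hi).1 (Ideal.pow_mem_pow hx i))
  rw [Ideal.mem_span_singleton']
  refine ⟨L, ?_⟩
  rw [← sub_eq_zero, ← neg_eq_zero, neg_sub]
  refine IsHausdorff.haus' (I := I) _ fun n => ?_
  have h1 := hL n
  rw [SModEq.sub_mem, smul_eq_mul, Ideal.mul_top] at h1
  rw [SModEq.zero, smul_eq_mul, Ideal.mul_top]
  have : a - L * f = f * (t n - L) + x ^ n * s n := by linear_combination ht n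
  rw [this]
  exact add_mem (Ideal.mul_mem_left _ _ h1) (Ideal.mul_mem_right _ _ (Ideal.pow_mem_pow hx n))

end TwoGenerated

/-! ### Two-dimensional regular local rings and their completions -/

section RegularLocal

open IsLocalRing

variable {R : Type*} [CommRing R]

/-- Take two minimal generators of the maximal ideal. If `yⁿ ∈ (x)`, the maximal ideal would be
minimal over `(x)`, hence of height at most one. -/
lemma exists_isParameterPair [IsRegularLocalRing R] (hdim : ringKrullDim R = 2) :
    ∃ x y : R, x ≠ 0 ∧ IsParameterPair x y := by
  have hrank : (maximalIdeal R).spanFinrank = 2 := by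
    have := IsRegularLocalRing.spanFinrank_maximalIdeal (R := R)
    rw [hdim] at this
    exact_mod_cast this
  have hcard := Submodule.FG.generators_ncard (IsNoetherian.noetherian (maximalIdeal R))
  rw [hrank, Set.ncard_eq_two] at hcard
  obtain ⟨x, y, -, hxy⟩ := hcard
  have hm : maximalIdeal R = Ideal.span {x, y} := by
    rw [← hxy]; exact (Submodule.span_generators _).symm
  have hx0 : x ≠ 0 := by
    rintro rfl
    have hy : maximalIdeal R = Submodule.span R {y} := by
      rw [hm]; exact Submodule.span_insert_zero
    have := Submodule.spanFinrank_span_le_ncard_of_finite (R := R) (Set.finite_singleton y)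
    rw [← hy, hrank, Set.ncard_singleton] at this
    omega
  refine ⟨x, y, hx0, .of_isNoetherianRing hm fun n hn => ?_⟩
  have hmin : maximalIdeal R ∈ (Ideal.span {x}).minimalPrimes := by
    refine ⟨⟨inferInstance, ?_⟩, fun q hq _ => ?_⟩
    · rw [hm]; exact Ideal.span_mono (by simp)
    · have := hq.1
      rw [hm, Ideal.span_le]
      rintro z (rfl | rfl)
      · exact hq.2 (Ideal.mem_span_singleton_self _)
      · exact hq.1.mem_of_pow_mem n (hq.2 hn)
  have h1 := Ideal.height_le_one_of_isPrincipal_of_mem_minimalPrimes _ _ hmin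
  have h2 := maximalIdeal_height_eq_ringKrullDim (R := R)
  rw [hdim] at h2
  have h3 : (maximalIdeal R).height = 2 := WithBot.coe_injective h2
  rw [h3] at h1
  exact absurd h1 (by decide)

/-- Height two yields primes `p < q < 𝔪`. The prime `q` is principal and not minimal, which forces
`p = 0`. -/
lemma isDomain_of_isRegularLocalRing_of_ringKrullDim_eq_two [IsRegularLocalRing R]
    (hdim : ringKrullDim R = 2) : IsDomain R := by
  obtain ⟨x, y, -, h⟩ := exists_isParameterPair hdim
  have h2 := maximalIdeal_height_eq_ringKrullDim (R := R)
  rw [hdim] at h2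
  have h3 : (maximalIdeal R).height = 2 := WithBot.coe_injective h2
  obtain ⟨q, hq, hqm, hqh⟩ : ∃ q : Ideal R, q.IsPrime ∧ q < maximalIdeal R ∧ 1 ≤ q.height := by
    have : ¬ (maximalIdeal R).height ≤ (1 : ℕ) := by rw [h3]; decide
    rw [Ideal.height_le_iff] at this
    push Not at this
    exact_mod_cast this
  obtain ⟨p, hp, hpq⟩ : ∃ p : Ideal R, p.IsPrime ∧ p < q := by
    have : ¬ q.height ≤ (0 : ℕ) := by
      rw [not_le, Nat.cast_zero]
      exact zero_lt_one.trans_le hqh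
    rw [Ideal.height_le_iff] at this
    push Not at this
    obtain ⟨p, hp, hpq, -⟩ := this
    exact ⟨p, hp, hpq⟩
  obtain ⟨f, rfl⟩ := h.exists_eq_span_singleton q hqm.ne
  exact isDomain_of_lt_span_singleton hq hpq

section Completion

variable [IsNoetherianRing R] [IsLocalRing R]

local notation "Rhat" => AdicCompletion (maximalIdeal R) R

instance faithfullyFlat_adicCompletion : Module.FaithfullyFlat R Rhat :=
  Module.FaithfullyFlat.of_flat_of_isLocalHom

/-- Extensions of ideals to the completion are closed. -/
lemma mem_map_of_forall_mem_sup (I : Ideal R) (a : Rhat)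
    (ha : ∀ n, a ∈ I.map (algebraMap R Rhat) ⊔ maximalIdeal Rhat ^ n) :
    a ∈ I.map (algebraMap R Rhat) := by
  -- `ψ` has kernel `I Rhat` and takes values in the completion of `R ⧸ I`, which is Hausdorff.
  let ψ : Rhat →ₗ[R] AdicCompletion (maximalIdeal R) (R ⧸ I) :=
    ((AdicCompletion.ofTensorProductEquivOfFiniteNoetherian (maximalIdeal R)
      (R ⧸ I)).toLinearMap.restrictScalars R) ∘ₗ
      ((TensorProduct.mk R Rhat (R ⧸ I)).flip 1)
  have hψ : ∀ b, ψ b = 0 → b ∈ I.map (algebraMap R Rhat) := by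
    intro b hb
    have h1 : b ⊗ₜ[R] (1 : R ⧸ I) = 0 := by
      apply (AdicCompletion.ofTensorProductEquivOfFiniteNoetherian (maximalIdeal R)
        (R ⧸ I)).injective
      rw [map_zero]
      exact hb
    rw [← Ideal.Quotient.eq_zero_iff_mem]
    apply (Algebra.TensorProduct.quotIdealMapEquivTensorQuot Rhat I).injective
    rw [map_zero, ← h1]
    simp
  have hψ' : ∀ b ∈ I.map (algebraMap R Rhat), ψ b = 0 := by
    intro b hb
    have h1 : b ⊗ₜ[R] (1 : R ⧸ I) = 0 := by
      rw [← Ideal.Quotient.eq_zero_iff_mem] at hb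
      have := congrArg (Algebra.TensorProduct.quotIdealMapEquivTensorQuot Rhat I) hb
      rw [map_zero] at this
      simpa using this
    show AdicCompletion.ofTensorProductEquivOfFiniteNoetherian (maximalIdeal R) (R ⧸ I)
      (b ⊗ₜ[R] (1 : R ⧸ I)) = 0
    rw [h1, map_zero]
  refine hψ a (IsHausdorff.haus (I := maximalIdeal R) inferInstance _ fun n => ?_)
  rw [SModEq.zero]
  obtain ⟨s, hs, t, ht, rfl⟩ := Submodule.mem_sup.mp (ha n)
  rw [map_add, hψ' s hs, zero_add]
  rw [AdicCompletion.maximalIdeal_eq_map, ← Ideal.map_pow] at ht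
  have ht' : t ∈ (maximalIdeal R ^ n • ⊤ : Submodule R Rhat) := by
    rw [Ideal.smul_top_eq_map]; exact ht
  have := Submodule.mem_map_of_mem (f := ψ) ht'
  rw [Submodule.map_smul''] at this
  exact Submodule.smul_mono le_rfl le_top this

lemma IsParameterPair.adicCompletion {x y : R} (h : IsParameterPair x y) :
    IsParameterPair (algebraMap R Rhat x) (algebraMap R Rhat y) := by
  have hx : Ideal.span {algebraMap R Rhat x} = (Ideal.span {x}).map (algebraMap R Rhat) := by
    rw [Ideal.map_span, Set.image_singleton]
  refine ⟨?_, ?_, ?_, ?_⟩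
  · rw [AdicCompletion.maximalIdeal_eq_map, h.maximalIdeal_eq, Ideal.map_span, Set.image_pair]
  · rw [hx]
    exact mem_map_of_forall_mem_sup _
  · intro n hn
    rw [hx, ← map_pow, ← Ideal.mem_comap, Ideal.comap_map_eq_self_of_faithfullyFlat] at hn
    exact h.pow_notMem n hn
  · refine le_span_singleton_of_isAdicComplete (I := maximalIdeal Rhat) ?_
    rw [AdicCompletion.maximalIdeal_eq_map]
    exact Ideal.mem_map_of_mem _ h.x_mem

/-- By flatness `x` stays a nonzerodivisor, so the prime `(x)` of the completion is not minimal. -/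
lemma IsParameterPair.isDomain_adicCompletion [IsDomain R] {x y : R} (hx0 : x ≠ 0)
    (h : IsParameterPair x y) : IsDomain Rhat := by
  have h' := h.adicCompletion
  have := h'.isNoetherianRing
  have hx := h'.isPrime_span
  have hreg : algebraMap R Rhat x ∈ nonZeroDivisors Rhat := by
    rw [mem_nonZeroDivisors_iff_right]
    intro z hz
    refine Module.Flat.isSMulRegular_of_nonZeroDivisors (M := Rhat)
      (mem_nonZeroDivisors_of_ne_zero hx0) ?_
    show x • z = x • (0 : Rhat)
    rw [smul_zero, Algebra.smul_def, mul_comm, hz]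
  obtain ⟨q, hq, hqx⟩ := Ideal.exists_minimalPrimes_le
    (bot_le : ⊥ ≤ Ideal.span {algebraMap R Rhat x})
  have := hq.1.1
  refine isDomain_of_lt_span_singleton hx (lt_of_le_of_ne hqx ?_)
  rintro rfl
  exact Set.disjoint_left.mp (Ideal.disjoint_nonZeroDivisors_of_mem_minimalPrimes hq)
    (Ideal.mem_span_singleton_self _) hreg

end Completion

end RegularLocal

/-! ### Linear functionals detecting `MV` -/

section Functionals

lemma coe_eq_sum_repr {V X ι : Type*} [CommRing V] [AddCommGroup X] [Module V X] [Fintype ι]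
    {N : Submodule V X} (b : Module.Basis ι V N) (x : X) (hx : x ∈ N) :
    x = ∑ i, b.repr ⟨x, hx⟩ i • (b i : X) :=
  calc x = N.subtype (∑ i, b.repr ⟨x, hx⟩ i • b i) := by rw [b.sum_repr]; rfl
    _ = _ := by rw [map_sum]; rfl

variable {R : Type*} [CommRing R] {M : Type*} [AddCommGroup M] [Module R M]

lemma fg_extend [Module.Finite R M] {V : Subring (FractionRing R)}
    (hV : (algebraMap R (FractionRing R)).range ≤ V) : (extend R M V).FG := by
  obtain ⟨S, hS⟩ := Module.finite_def.mp (inferInstance : Module.Finite R M)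
  classical
  refine ⟨S.image (toGeneric R M), le_antisymm (Submodule.span_mono ?_) ?_⟩
  · rw [Finset.coe_image]; exact Set.image_subset_range _ _
  · rw [extend, Submodule.span_le]
    rintro _ ⟨m, rfl⟩
    have hm : m ∈ Submodule.span R (S : Set M) := hS ▸ Submodule.mem_top
    show toGeneric R M m ∈ Submodule.span V _
    induction hm using Submodule.span_induction with
    | mem m hm => exact Submodule.subset_span (by simpa using ⟨m, hm, rfl⟩)
    | zero => rw [map_zero]; exact zero_mem _
    | add a b _ _ ha hb => rw [map_add]; exact add_mem ha hb
    | smul r m _ hm =>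
      have hr : algebraMap R (FractionRing R) r ∈ V := hV (RingHom.mem_range_self _ r)
      have : toGeneric R M (r • m) = (⟨_, hr⟩ : V) • toGeneric R M m := by
        rw [map_smul, ← algebraMap_smul (FractionRing R) r]
        rfl
      rw [this]
      exact Submodule.smul_mem _ _ hm

lemma span_range_toGeneric :
    Submodule.span (FractionRing R) (Set.range (toGeneric R M)) = ⊤ := by
  rw [eq_top_iff]
  rintro x -
  induction x using TensorProduct.induction_on with
  | zero => exact zero_mem _
  | add a b ha hb => exact add_mem ha hb
  | tmul k m =>
    have : k ⊗ₜ[R] m = k • toGeneric R M m := by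
      simp [toGeneric, TensorProduct.smul_tmul']
    rw [this]
    exact Submodule.smul_mem _ _ (Submodule.subset_span ⟨m, rfl⟩)

/-- An element outside `MV` is detected by a linear functional which is `V`-valued on `M`. -/
lemma exists_functional_notMem [IsDomain R] [Module.Finite R M] {V : Subring (FractionRing R)}
    (hDVR : IsDVROf V) (hV : (algebraMap R (FractionRing R)).range ≤ V) {f : Generic R M}
    (hf : f ∉ extend R M V) :
    ∃ ψ : Generic R M →ₗ[FractionRing R] FractionRing R,
      (∀ m, ψ (toGeneric R M m) ∈ V) ∧ ψ f ∉ V := by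
  have := hDVR.isDomain
  have := hDVR.isDiscreteValuationRing
  have := hDVR.isFractionRing
  have : Module.Finite V (extend R M V) := Module.Finite.iff_fg.mpr (fg_extend hV)
  have : IsScalarTower V (FractionRing R) (Generic R M) := inferInstance
  have : Module.IsTorsionFree V (Generic R M) :=
    Module.IsTorsionFree.trans_faithfulSMul V (FractionRing R) (Generic R M)
  have : Module.IsTorsionFree V (extend R M V) := inferInstance
  -- `MV` is finite and torsion-free over a principal ideal domain, hence free. Its basis is also a
  -- basis of `M_K`, and some coordinate of `f` must lie outside `V`.
  obtain ⟨n, b⟩ := Module.basisOfFiniteTypeTorsionFree' (R := V) (M := extend R M V)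
  let e : Fin n → Generic R M := fun i => b i
  have hli : LinearIndependent (FractionRing R) e := by
    rw [← LinearIndependent.iff_fractionRing V]
    exact b.linearIndependent.map' (extend R M V).subtype (Submodule.ker_subtype _)
  have hsum : ∀ x (hx : x ∈ extend R M V),
      x = ∑ i, ((b.repr ⟨x, hx⟩ i : V) : FractionRing R) • e i := 
    coe_eq_sum_repr b
  have hspan : ⊤ ≤ Submodule.span (FractionRing R) (Set.range e) := by
    rw [← span_range_toGeneric, Submodule.span_le]
    rintro _ ⟨m, rfl⟩
    have := hsum (toGeneric R M m) (Submodule.subset_span ⟨m, rfl⟩)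
    rw [SetLike.mem_coe, this]
    exact sum_mem fun i _ => Submodule.smul_mem _ _ (Submodule.subset_span ⟨i, rfl⟩)
  let E := Module.Basis.mk hli hspan
  have hE : ∀ i, E i = e i := fun i => by simp [E]
  obtain ⟨i, hi⟩ : ∃ i, E.repr f i ∉ V := by
    by_contra! hcon
    apply hf
    rw [← E.sum_repr f]
    refine sum_mem fun i _ => ?_
    rw [hE]
    exact (extend R M V).smul_mem ⟨_, hcon i⟩ (b i).2
  refine ⟨E.coord i, fun m => ?_, hi⟩
  have := hsum (toGeneric R M m) (Submodule.subset_span ⟨m, rfl⟩)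
  simp only [← hE] at this
  rw [this, Module.Basis.coord_apply, E.repr_sum_self]
  exact Subtype.property _

end Functionals

/-! ### Faithfully flat base change and descent of integrality -/

section BaseChange

variable (R : Type*) [CommRing R] [IsDomain R] (A : Type*) [CommRing A] [IsDomain A] [Algebra R A]
  [Module.FaithfullyFlat R A] (M : Type*) [AddCommGroup M] [Module R M]

/-- The embedding of fraction fields induced by a faithfully flat extension of domains. -/
noncomputable def fractionMap : FractionRing R →ₐ[R] FractionRing A :=
  IsFractionRing.liftAlgHom (g := Algebra.ofId R (FractionRing A)) <| by
    have : Function.Injective (algebraMap R (FractionRing A)) := by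
      rw [IsScalarTower.algebraMap_eq R A (FractionRing A)]
      exact (IsFractionRing.injective A _).comp (FaithfulSMul.algebraMap_injective R A)
    exact this

/-- The canonical map `M_K → (A ⊗ M)_K'`. -/
noncomputable def genericMap : Generic R M →ₗ[R] Generic A (A ⊗[R] M) :=
  ((TensorProduct.AlgebraTensorModule.cancelBaseChange R A (FractionRing A) (FractionRing A)
    M).symm.toLinearMap.restrictScalars R) ∘ₗ LinearMap.rTensor M (fractionMap R A).toLinearMap

@[simp]
lemma genericMap_tmul (k : FractionRing R) (m : M) :
    genericMap R A M (k ⊗ₜ m) = fractionMap R A k ⊗ₜ[A] ((1 : A) ⊗ₜ[R] m) := by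
  simp [genericMap]

variable {R M}

/-- The base change of a linear functional. -/
noncomputable def functionalMap (ψ : Generic R M →ₗ[FractionRing R] FractionRing R) :
    Generic A (A ⊗[R] M) →ₗ[FractionRing A] FractionRing A :=
  (LinearMap.liftBaseChange (FractionRing A)
    ((fractionMap R A).toLinearMap ∘ₗ ψ.restrictScalars R ∘ₗ toGeneric R M)) ∘ₗ
  (TensorProduct.AlgebraTensorModule.cancelBaseChange R A (FractionRing A) (FractionRing A)
    M).toLinearMap

lemma functionalMap_tmul (ψ : Generic R M →ₗ[FractionRing R] FractionRing R) (k : FractionRing A)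
    (a : A) (m : M) : functionalMap A ψ (k ⊗ₜ (a ⊗ₜ m)) =
      (a • k) * fractionMap R A (ψ (toGeneric R M m)) := by
  simp [functionalMap]

lemma functionalMap_genericMap (ψ : Generic R M →ₗ[FractionRing R] FractionRing R)
    (x : Generic R M) : functionalMap A ψ (genericMap R A M x) = fractionMap R A (ψ x) := by
  induction x using TensorProduct.induction_on with
  | zero => simp
  | add a b ha hb => simp [ha, hb]
  | tmul k m =>
    have : k ⊗ₜ[R] m = k • toGeneric R M m := by
      simp [toGeneric, TensorProduct.smul_tmul']
    rw [genericMap_tmul, functionalMap_tmul, one_smul, this, map_smul, smul_eq_mul, map_mul]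

/-- Every element of `A ⊗ K` becomes `a ⊗ 1` after multiplication by some nonzero `s : R`, and by
flatness `s` acts injectively. -/
lemma injective_liftBaseChange_fractionMap :
    Function.Injective ((fractionMap R A).toLinearMap.liftBaseChange A) := by
  rw [injective_iff_map_eq_zero]
  intro z hz
  have hden : ∃ s : R, s ≠ 0 ∧ ∃ a : A, s • z = a ⊗ₜ[R] (1 : FractionRing R) := by
    clear hz
    induction z using TensorProduct.induction_on with
    | zero => exact ⟨1, one_ne_zero, 0, by simp⟩
    | add z w hz hw =>
      obtain ⟨s, hs, a, ha⟩ := hz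
      obtain ⟨t, ht, b, hb⟩ := hw
      refine ⟨s * t, mul_ne_zero hs ht, t • a + s • b, ?_⟩
      rw [smul_add, TensorProduct.add_tmul, ← TensorProduct.smul_tmul', ← TensorProduct.smul_tmul',
        ← ha, ← hb, smul_smul, smul_smul, mul_comm t s]
    | tmul a k =>
      obtain ⟨r, s, hs, rfl⟩ := IsFractionRing.div_surjective (A := R) k
      have hs0 := nonZeroDivisors.ne_zero hs
      refine ⟨s, hs0, r • a, ?_⟩
      rw [← TensorProduct.tmul_smul, TensorProduct.smul_tmul]
      congr 1
      have : algebraMap R (FractionRing R) s ≠ 0 := by simpa using hs0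
      rw [Algebra.smul_def, Algebra.smul_def, mul_one, mul_div_cancel₀ _ this]
  obtain ⟨s, hs, a, ha⟩ := hden
  have h1 := congrArg ((fractionMap R A).toLinearMap.liftBaseChange A) ha
  rw [LinearMap.map_smul_of_tower, hz, smul_zero, LinearMap.liftBaseChange_tmul,
    AlgHom.toLinearMap_apply, map_one, Algebra.smul_def, mul_one, eq_comm,
    map_eq_zero_iff _ (IsFractionRing.injective A _)] at h1
  rw [h1, TensorProduct.zero_tmul] at ha
  have hinj : Function.Injective (LinearMap.lTensor A (LinearMap.lsmul R (FractionRing R) s)) := by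
    refine Module.Flat.lTensor_preserves_injective_linearMap _ ?_
    intro x y hxy
    simpa [hs] using hxy
  apply hinj
  have h2 : LinearMap.lTensor A (LinearMap.lsmul R (FractionRing R) s) z = s • z := by
    have : LinearMap.lsmul R (FractionRing R) s = s • LinearMap.id := rfl
    rw [this, LinearMap.lTensor_smul, LinearMap.lTensor_id]; rfl
  rw [h2, ha, map_zero]

/-- Submodules of the fraction field are contracted from a faithfully flat extension. -/
lemma mem_of_fractionMap_mem_span (L : Submodule R (FractionRing R)) {c : FractionRing R}
    (hc : fractionMap R A c ∈ Submodule.span A (fractionMap R A '' L)) : c ∈ L := by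
  have hspan : ∀ z ∈ Submodule.span A (fractionMap R A '' L), ∃ t : A ⊗[R] L,
      (fractionMap R A).toLinearMap.liftBaseChange A (LinearMap.lTensor A L.subtype t) = z := by
    intro z hz
    induction hz using Submodule.span_induction with
    | mem x hx =>
      obtain ⟨l, hl, rfl⟩ := hx
      exact ⟨1 ⊗ₜ ⟨l, hl⟩, by simp⟩
    | zero => exact ⟨0, by simp⟩
    | add x y _ _ hx hy =>
      obtain ⟨t, rfl⟩ := hx
      obtain ⟨u, rfl⟩ := hy
      exact ⟨t + u, by simp⟩
    | smul a x _ hx =>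
      obtain ⟨t, rfl⟩ := hx
      refine ⟨a • t, ?_⟩
      have : LinearMap.lTensor A L.subtype (a • t) = a • LinearMap.lTensor A L.subtype t :=
        (L.subtype.baseChange A).map_smul a t
      rw [this, map_smul]
  obtain ⟨t, ht⟩ := hspan _ hc
  have h1 : LinearMap.lTensor A L.subtype t = 1 ⊗ₜ c := by
    apply injective_liftBaseChange_fractionMap A
    rw [ht]; simp
  -- The class of `c` in `K ⧸ L` dies after tensoring with `A`, hence is already zero.
  have h2 := congrArg (LinearMap.lTensor A L.mkQ) h1
  rw [← LinearMap.lTensor_comp_apply, LinearMap.lTensor_tmul] at h2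
  have h3 : L.mkQ ∘ₗ L.subtype = 0 := by ext x; simp
  rw [h3, LinearMap.lTensor_zero, LinearMap.zero_apply, eq_comm] at h2
  have h4 : L.mkQ c = 0 := by
    apply Module.FaithfullyFlat.tensorProduct_mk_injective (A := R) (B := A)
    rw [map_zero]; exact h2
  simpa using h4

/-- Integrality over a module descends along faithfully flat extensions. -/
theorem isIntegralOver_of_genericMap [IsNoetherianRing A] [Module.Finite R M] {f : Generic R M}
    (hf : IsIntegralOver (genericMap R A M f)) : IsIntegralOver f := by
  intro V hDVR hV
  by_contra hfV
  obtain ⟨ψ, hψM, hψf⟩ := exists_functional_notMem hDVR hV hfV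
  set c := ψ f with hc
  have hc0 : c ≠ 0 := fun h => hψf (h ▸ V.zero_mem)
  have hcinv : c⁻¹ ∈ V := by
    have := hDVR.isDomain
    have := hDVR.isDiscreteValuationRing
    have := hDVR.isFractionRing
    rcases ValuationRing.isInteger_or_isInteger V c with ⟨v, hv⟩ | ⟨v, hv⟩
    · exact absurd (hv ▸ v.2) hψf
    · exact hv ▸ v.2
  obtain ⟨S, hS⟩ := Module.finite_def.mp (inferInstance : Module.Finite R M)
  classical
  -- Adjoining `c⁻¹` makes it a nonunit of the resulting ring: an inverse would be `c`, which is
  -- outside `V`.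
  let G : Finset (FractionRing R) := insert c⁻¹ (S.image fun m => ψ (toGeneric R M m))
  let T₀ : Subalgebra R (FractionRing R) := Algebra.adjoin R G
  have hT₀V : ∀ x ∈ T₀, x ∈ V := by
    let V' : Subalgebra R (FractionRing R) := { V with algebraMap_mem' := fun r => hV ⟨r, rfl⟩ }
    have : T₀ ≤ V' := by
      refine Algebra.adjoin_le ?_
      intro x hx
      rcases Finset.mem_insert.mp hx with rfl | hx
      · exact hcinv
      · obtain ⟨m, -, rfl⟩ := Finset.mem_image.mp hx
        exact hψM m
    exact this
  let G' : Finset (FractionRing A) := G.image (fractionMap R A)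
  let T : Subalgebra A (FractionRing A) := Algebra.adjoin A G'
  have hTspan : ∀ x ∈ T, x ∈ Submodule.span A (fractionMap R A '' T₀) := by
    intro x hx
    have h1 : x ∈ Subalgebra.toSubmodule T := hx
    rw [Algebra.adjoin_eq_span] at h1
    refine Submodule.span_mono ?_ h1
    have : Submonoid.closure (G' : Set (FractionRing A)) ≤
        T₀.toSubmonoid.map (fractionMap R A : FractionRing R →* FractionRing A) := by
      rw [Submonoid.closure_le]
      intro y hy
      obtain ⟨z, hz, rfl⟩ := Finset.mem_image.mp hy
      exact ⟨z, Algebra.subset_adjoin hz, rfl⟩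
    exact this
  have hcT : fractionMap R A c ∉ T := fun h =>
    hψf (hT₀V _ (mem_of_fractionMap_mem_span A (Subalgebra.toSubmodule T₀) (hTspan _ h)))
  have hgT : fractionMap R A c⁻¹ ∈ T :=
    Algebra.subset_adjoin (Finset.mem_image_of_mem _ (Finset.mem_insert_self _ _))
  have hTN : IsNoetherianRing T := isNoetherianRing_of_fg ⟨G', rfl⟩
  have : IsNoetherianRing T.toSubring := hTN
  have : IsFractionRing T.toSubring (FractionRing A) := inferInstanceAs (IsFractionRing T _)
  have hc0' : fractionMap R A c⁻¹ ≠ 0 := (map_ne_zero _).mpr (inv_ne_zero hc0)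
  obtain ⟨W, hW, hTW, hcW⟩ := exists_isDVROf_inv_notMem T.toSubring hgT hc0' (by
    rw [map_inv₀, inv_inv]; exact hcT)
  rw [map_inv₀, inv_inv] at hcW
  have hAW : (algebraMap A (FractionRing A)).range ≤ W := by
    rintro _ ⟨a, rfl⟩
    exact hTW (T.algebraMap_mem a)
  have hM : ∀ m, fractionMap R A (ψ (toGeneric R M m)) ∈ W := by
    intro m
    have hm : m ∈ Submodule.span R (S : Set M) := hS ▸ Submodule.mem_top
    induction hm using Submodule.span_induction with
    | mem m hm =>
      exact hTW (Algebra.subset_adjoin (Finset.mem_image_of_mem _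
        (Finset.mem_insert_of_mem (Finset.mem_image_of_mem _ hm))))
    | zero => simp
    | add a b _ _ ha hb => simpa using add_mem ha hb
    | smul r m _ hm =>
      rw [map_smul, LinearMap.map_smul_of_tower, map_smul, Algebra.smul_def,
        IsScalarTower.algebraMap_apply R A]
      exact mul_mem (hAW ⟨_, rfl⟩) hm
  -- The base-changed functional is `W`-valued on `(A ⊗ M)W`, so integrality of `f` would put `c` in
  -- `W`.
  have hext : ∀ x ∈ extend A (A ⊗[R] M) W, functionalMap A ψ x ∈ W := by
    intro x hx
    unfold extend at hx
    induction hx using Submodule.span_induction with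
    | mem x hx =>
      obtain ⟨y, rfl⟩ := hx
      induction y using TensorProduct.induction_on with
      | zero => simp
      | add a b ha hb => simpa using add_mem ha hb
      | tmul a m =>
        rw [toGeneric, TensorProduct.mk_apply, functionalMap_tmul, Algebra.smul_def, mul_one]
        exact mul_mem (hAW ⟨_, rfl⟩) (hM m)
    | zero => simp
    | add a b _ _ ha hb => simpa using add_mem ha hb
    | smul w x _ hx =>
      have : functionalMap A ψ (w • x) = w * functionalMap A ψ x :=
        (functionalMap A ψ).map_smul (w : FractionRing A) x
      rw [this]
      exact mul_mem w.2 hx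
  apply hcW
  rw [hc, ← functionalMap_genericMap A ψ f]
  exact hext _ (hf W hW hAW)

end BaseChange

/-! ### Integral elements at nonmaximal primes -/

lemma injective_toGeneric {A N : Type*} [CommRing A] [IsDomain A] [AddCommGroup N] [Module A N]
    [Module.IsTorsionFree A N] : Function.Injective (toGeneric A N) := by
  rw [injective_iff_map_eq_zero]
  intro n hn
  have : IsLocalizedModule (nonZeroDivisors A) (toGeneric A N) :=
    (isLocalizedModule_iff_isBaseChange (nonZeroDivisors A) (FractionRing A) _).mpr
      (TensorProduct.isBaseChange A N (FractionRing A))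
  rw [IsLocalizedModule.eq_zero_iff (nonZeroDivisors A)] at hn
  obtain ⟨c, hc⟩ := hn
  exact (smul_eq_zero.mp hc).resolve_left (nonZeroDivisors.ne_zero c.2)

lemma mem_extend_of_mem_range {A N : Type*} [CommRing A] [AddCommGroup N] [Module A N]
    {x : Generic A N} (hx : x ∈ Set.range (toGeneric A N)) (V : Subring (FractionRing A)) :
    x ∈ extend A N V :=
  Submodule.subset_span hx

lemma exists_smul_mem_range {A N : Type*} [CommRing A] [IsDomain A] [AddCommGroup N] [Module A N]
    (x : Generic A N) : ∃ s : A, s ≠ 0 ∧ s • x ∈ LinearMap.range (toGeneric A N) := by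
  induction x using TensorProduct.induction_on with
  | zero => exact ⟨1, one_ne_zero, by simp⟩
  | add x y hx hy =>
    obtain ⟨s, hs, hx⟩ := hx
    obtain ⟨t, ht, hy⟩ := hy
    refine ⟨s * t, mul_ne_zero hs ht, ?_⟩
    rw [smul_add]
    refine add_mem ?_ ?_
    · rw [mul_comm, mul_smul]; exact Submodule.smul_mem _ _ hx
    · rw [mul_smul]; exact Submodule.smul_mem _ _ hy
  | tmul k n =>
    obtain ⟨r, s, hs, rfl⟩ := IsFractionRing.div_surjective (A := A) k
    have hs0 := nonZeroDivisors.ne_zero hs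
    refine ⟨s, hs0, r • n, ?_⟩
    have : algebraMap A (FractionRing A) s ≠ 0 := by simpa using hs0
    rw [TensorProduct.smul_tmul', Algebra.smul_def, mul_div_cancel₀ _ this, map_smul, toGeneric,
      TensorProduct.mk_apply, TensorProduct.smul_tmul', Algebra.smul_def, mul_one]

/-- An integral element over `N` lies in `N` locally at every prime element. -/
lemma IsIntegralOver.exists_smul_mem_range {A N : Type*} [CommRing A] [IsDomain A]
    [IsNoetherianRing A] [AddCommGroup N] [Module A N] {x : Generic A N} (hx : IsIntegralOver x)
    {f : A} (hf : Prime f) :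
    ∃ s ∉ Ideal.span {f}, s • x ∈ LinearMap.range (toGeneric A N) := by
  have hP : (Ideal.span {f}).IsPrime := (Ideal.span_singleton_prime hf.ne_zero).mpr hf
  obtain ⟨W, hW, hAW, hWf⟩ := exists_isDVROf_of_prime (K := FractionRing A) hf
  have hmem := hx W hW hAW
  clear hx
  unfold extend at hmem
  induction hmem using Submodule.span_induction with
  | mem x hx => exact ⟨1, hP.one_notMem, by rw [one_smul]; exact hx⟩
  | zero => exact ⟨1, hP.one_notMem, by simp⟩
  | add x y _ _ hx hy =>
    obtain ⟨s, hs, hx⟩ := hx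
    obtain ⟨t, ht, hy⟩ := hy
    refine ⟨s * t, hP.mul_notMem hs ht, ?_⟩
    rw [smul_add]
    refine add_mem ?_ ?_
    · rw [mul_comm, mul_smul]; exact Submodule.smul_mem _ _ hx
    · rw [mul_smul]; exact Submodule.smul_mem _ _ hy
  | smul w x _ hx =>
    obtain ⟨s, hs, hx⟩ := hx
    obtain ⟨t, ht, a, hta⟩ := hWf w w.2
    refine ⟨t * s, hP.mul_notMem ht hs, ?_⟩
    have : (t * s) • (w • x) = a • s • x := by
      have h1 : w • x = (w : FractionRing A) • x := rfl
      rw [h1, ← algebraMap_smul (FractionRing A) (t * s), ← algebraMap_smul (FractionRing A) a,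
        ← algebraMap_smul (FractionRing A) s, ← hta, map_mul, smul_smul, smul_smul]
      congr 1
      ring
    rw [this]
    exact Submodule.smul_mem _ _ hx

open IsLocalRing in
/-- If every nonmaximal prime ideal is principal, then an integral element over `N` is multiplied
into `N` by a power of the maximal ideal. -/
lemma IsIntegralOver.exists_maximalIdeal_pow_smul_mem_range {A N : Type*} [CommRing A] [IsDomain A]
    [IsLocalRing A] [IsNoetherianRing A]
    (hA : ∀ P : Ideal A, P.IsPrime → P ≠ maximalIdeal A → ∃ f, P = Ideal.span {f})
    [AddCommGroup N] [Module A N] {x : Generic A N} (hx : IsIntegralOver x) :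
    ∃ k : ℕ, ∀ a ∈ maximalIdeal A ^ k, a • x ∈ LinearMap.range (toGeneric A N) := by
  let J : Ideal A := (LinearMap.range (toGeneric A N)).comap (LinearMap.toSpanSingleton A _ x)
  have hJ : ∀ a, a ∈ J ↔ a • x ∈ LinearMap.range (toGeneric A N) := fun a => Iff.rfl
  have hrad : maximalIdeal A ≤ J.radical := by
    rw [Ideal.radical_eq_sInf]
    refine le_sInf fun P hP => ?_
    have hPp := hP.2
    by_contra hPm
    obtain ⟨f, rfl⟩ := hA P hPp (fun h => hPm h.ge)
    have : ∃ s ∉ Ideal.span {f}, s • x ∈ LinearMap.range (toGeneric A N) := by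
      -- At the zero prime, clearing denominators suffices; at the others, integrality is tested on
      -- the localization.
      by_cases hf : f = 0
      · obtain ⟨s, hs, hsx⟩ := ModuleClosure.exists_smul_mem_range x
        exact ⟨s, by simpa [hf] using hs, hsx⟩
      · exact hx.exists_smul_mem_range ((Ideal.span_singleton_prime hf).mp hPp)
    obtain ⟨s, hs, hsx⟩ := this
    exact hs (hP.1 ((hJ s).mpr hsx))
  obtain ⟨k, hk⟩ := Ideal.exists_pow_le_of_le_radical_of_fg hrad (IsNoetherian.noetherian _)
  exact ⟨k, fun a ha => (hJ a).mp (hk ha)⟩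

/-! ### Torsion and approximation under flat base change -/

section Flat

lemma lTensor_pi_eq_zero {R A M ι : Type*} [CommRing R] [CommRing A] [Algebra R A] [AddCommGroup M]
    [Module R M] [Finite ι] {N : ι → Type*} [∀ i, AddCommGroup (N i)] [∀ i, Module R (N i)]
    (g : ∀ i, M →ₗ[R] N i) {z : A ⊗[R] M} (hz : ∀ i, LinearMap.lTensor A (g i) z = 0) :
    LinearMap.lTensor A (LinearMap.pi g) z = 0 := by
  have := Fintype.ofFinite ι
  classical
  apply (TensorProduct.piRight R R A N).injective
  rw [map_zero]
  ext i
  rw [Pi.zero_apply, ← hz i]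
  clear hz
  induction z using TensorProduct.induction_on with
  | zero => simp
  | add x y hx hy => simp only [map_add, Pi.add_apply, hx, hy]
  | tmul a m => simp

variable {R : Type*} [CommRing R] [IsDomain R] (A : Type*) [CommRing A] [IsDomain A] [Algebra R A]
  [Module.FaithfullyFlat R A] (M : Type*) [AddCommGroup M] [Module R M]

/-- Coordinates embed `M` in `Kⁿ`; by flatness `A ⊗ M` embeds in `(A ⊗ K)ⁿ`, hence in `K'ⁿ`. -/
instance isTorsionFree_tensorProduct [Module.Finite R M] [Module.IsTorsionFree R M] :
    Module.IsTorsionFree A (A ⊗[R] M) := by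
  let b := Module.finBasis (FractionRing R) (Generic R M)
  let ψ : ∀ _ : Fin _, M →ₗ[R] FractionRing R := fun i =>
    (b.coord i).restrictScalars R ∘ₗ toGeneric R M
  have hψ : Function.Injective (LinearMap.pi ψ) := by
    intro m n hmn
    apply injective_toGeneric (A := R)
    apply b.ext_elem
    intro i
    exact congrFun hmn i
  refine ⟨fun a ha => ?_⟩
  have ha0 : a ≠ 0 := ha.ne_zero
  rw [isSMulRegular_iff_right_eq_zero_of_smul]
  intro z hz
  apply Module.Flat.lTensor_preserves_injective_linearMap (M := A) _ hψ
  rw [map_zero]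
  refine lTensor_pi_eq_zero ψ fun i => ?_
  apply injective_liftBaseChange_fractionMap A
  rw [map_zero]
  have h1 : a • (fractionMap R A).toLinearMap.liftBaseChange A (LinearMap.lTensor A (ψ i) z) = 0 := by
    have : a • LinearMap.lTensor A (ψ i) z = LinearMap.lTensor A (ψ i) (a • z) :=
      (((ψ i).baseChange A).map_smul a z).symm
    rw [← map_smul, this, hz, map_zero, map_zero]
  exact (smul_eq_zero.mp h1).resolve_left ha0

lemma genericMap_toGeneric (m : M) :
    genericMap R A M (toGeneric R M m) = toGeneric A (A ⊗[R] M) (1 ⊗ₜ m) := by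
  simp [toGeneric]

variable {M}

/-- If `A` is dense modulo powers of the extension of an ideal `I` of `R`, then every element of
`(A ⊗ M)_K'` which is multiplied into `A ⊗ M` by `Iᵏ` is congruent to an element of `M_K`. -/
lemma exists_sub_genericMap_mem_range [IsNoetherianRing R] [Module.Finite R M]
    [Module.IsTorsionFree R M] (I : Ideal R) (hI : I ≠ ⊥)
    (hdense : ∀ a : A, ∃ r : R, a - algebraMap R A r ∈ I.map (algebraMap R A))
    {v : Generic A (A ⊗[R] M)}
    (hv : ∀ r ∈ I, algebraMap R A r • v ∈ LinearMap.range (toGeneric A (A ⊗[R] M))) :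
    ∃ f : Generic R M, v - genericMap R A M f ∈ LinearMap.range (toGeneric A (A ⊗[R] M)) := by
  obtain ⟨d, hdI, hd0⟩ := Submodule.exists_mem_ne_zero_of_ne_bot hI
  obtain ⟨w, hw⟩ := hv d hdI
  -- With `v = w / d`, only the class of `w` in `A ⊗ (M ⧸ dM)` matters, and `I` annihilates it.
  let Q := M ⧸ LinearMap.range (LinearMap.lsmul R M d)
  let π : M →ₗ[R] Q := Submodule.mkQ _
  have hπ : Function.Exact (LinearMap.lsmul R M d) π := LinearMap.exact_map_mkQ_range _
  have hπA := lTensor_exact A hπ (Submodule.mkQ_surjective _)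
  have hlsmul : ∀ z : A ⊗[R] M, LinearMap.lTensor A (LinearMap.lsmul R M d) z =
      algebraMap R A d • z := fun z => by
    have : LinearMap.lsmul R M d = d • LinearMap.id := rfl
    rw [this, LinearMap.lTensor_smul, LinearMap.lTensor_id, algebraMap_smul]; rfl
  have hq : ∀ r ∈ I, r • LinearMap.lTensor A π w = 0 := by
    intro r hr
    obtain ⟨w', hw'⟩ := hv r hr
    have h1 : algebraMap R A r • w = algebraMap R A d • w' := by
      apply injective_toGeneric (A := A)
      rw [map_smul, map_smul, hw, hw', smul_comm]
    rw [← map_smul, ← algebraMap_smul A r w, h1, ← hlsmul]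
    exact hπA.apply_apply_eq_zero w'
  obtain ⟨S, hS⟩ := (IsNoetherian.noetherian I : I.FG)
  -- `ker g` is the `I`-torsion of `Q`, as the kernel of a map into a finite product; flatness
  -- places the class of `w` in the image of `A ⊗ ker g`.
  let g : Q →ₗ[R] (S → Q) := LinearMap.pi fun s : S => LinearMap.lsmul R Q (s : R)
  have hg : Function.Exact (LinearMap.ker g).subtype g := g.exact_subtype_ker_map
  have hgI : ∀ n ∈ LinearMap.ker g, ∀ r ∈ I, r • n = 0 := by
    intro n hn r hr
    rw [← hS] at hr
    induction hr using Submodule.span_induction with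
    | mem s hs => exact congrFun (LinearMap.mem_ker.mp hn) ⟨s, hs⟩
    | zero => simp
    | add a b _ _ ha hb => rw [add_smul, ha, hb, add_zero]
    | smul a b _ hb => rw [smul_eq_mul, mul_smul, hb, smul_zero]
  obtain ⟨t, ht⟩ := (Module.Flat.lTensor_exact A hg _).mp
    (lTensor_pi_eq_zero (A := A) (z := LinearMap.lTensor A π w)
      (fun s : S => LinearMap.lsmul R Q (s : R)) fun s => by
        have : LinearMap.lsmul R Q (s : R) = (s : R) • LinearMap.id := rfl
        rw [this, LinearMap.lTensor_smul, LinearMap.lTensor_id, LinearMap.smul_apply,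
          LinearMap.id_apply]
        exact hq _ (hS ▸ Submodule.subset_span s.2))
  -- Since `A = R + IA` and `I` kills `ker g`, tensoring with `A` adds no new elements.
  have hpure : ∀ t : A ⊗[R] LinearMap.ker g, ∃ n, t = 1 ⊗ₜ n := by
    intro t
    induction t using TensorProduct.induction_on with
    | zero => exact ⟨0, by simp⟩
    | add a b ha hb =>
      obtain ⟨m, rfl⟩ := ha
      obtain ⟨n, rfl⟩ := hb
      exact ⟨m + n, (TensorProduct.tmul_add _ _ _).symm⟩
    | tmul a n =>
      obtain ⟨r, hr⟩ := hdense a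
      refine ⟨r • n, ?_⟩
      have h0 : ∀ b ∈ I.map (algebraMap R A), b ⊗ₜ[R] n = 0 := by
        intro b hb
        rw [← Submodule.restrictScalars_mem R, ← Ideal.smul_top_eq_map] at hb
        refine Submodule.smul_induction_on hb (fun r hr a _ => ?_) fun a b ha hb => ?_
        · rw [TensorProduct.smul_tmul]
          have : r • n = 0 := Subtype.ext (hgI n n.2 r hr)
          rw [this, TensorProduct.tmul_zero]
        · rw [TensorProduct.add_tmul, ha, hb, add_zero]
      have := h0 _ hr
      rw [TensorProduct.sub_tmul, sub_eq_zero] at this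
      rw [this, ← TensorProduct.smul_tmul, Algebra.smul_def, mul_one]
  obtain ⟨n, rfl⟩ := hpure t
  obtain ⟨m, hm⟩ := Submodule.mkQ_surjective _ (n : Q)
  have hker : LinearMap.lTensor A π (w - 1 ⊗ₜ m) = 0 := by
    rw [map_sub, ← ht, LinearMap.lTensor_tmul, LinearMap.lTensor_tmul, sub_eq_zero]
    exact congrArg _ hm.symm
  obtain ⟨w', hw'⟩ := (hπA _).mp hker
  rw [hlsmul] at hw'
  have hdK : algebraMap R (FractionRing R) d ≠ 0 := by simpa using hd0
  -- From `w - 1 ⊗ m = d w'`, division by `d` gives `v - m / d = w'`.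
  refine ⟨(algebraMap R (FractionRing R) d)⁻¹ • toGeneric R M m, w', ?_⟩
  have hdf : d • genericMap R A M ((algebraMap R (FractionRing R) d)⁻¹ • toGeneric R M m) =
      toGeneric A (A ⊗[R] M) (1 ⊗ₜ m) := by
    rw [← map_smul, ← algebraMap_smul (FractionRing R) d, smul_inv_smul₀ hdK, genericMap_toGeneric]
  have hdA : algebraMap A (FractionRing A) (algebraMap R A d) ≠ 0 := by
    rw [Ne, map_eq_zero_iff _ (IsFractionRing.injective A _),
      map_eq_zero_iff _ (FaithfulSMul.algebraMap_injective R A)]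
    exact hd0
  have hsmul : algebraMap R A d • toGeneric A (A ⊗[R] M) w' = algebraMap R A d •
      (v - genericMap R A M ((algebraMap R (FractionRing R) d)⁻¹ • toGeneric R M m)) := by
    rw [← map_smul, hw', map_sub, hw, smul_sub, ← hdf, algebraMap_smul A d, algebraMap_smul A d]
  rw [← algebraMap_smul (FractionRing A) (algebraMap R A d),
    ← algebraMap_smul (FractionRing A) (algebraMap R A d)] at hsmul
  exact smul_right_injective (Generic A (A ⊗[R] M)) hdA hsmul

end Flat

open IsLocalRing in
lemma exists_sub_algebraMap_mem_map_pow {R : Type*} [CommRing R] [IsNoetherianRing R]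
    [IsLocalRing R] (k : ℕ) (a : AdicCompletion (maximalIdeal R) R) :
    ∃ r : R, a - algebraMap R _ r ∈
      (maximalIdeal R ^ k).map (algebraMap R (AdicCompletion (maximalIdeal R) R)) := by
  obtain ⟨r, hr⟩ := Submodule.mkQ_surjective _ (AdicCompletion.eval (maximalIdeal R) R k a)
  refine ⟨r, ?_⟩
  rw [← Submodule.restrictScalars_mem R, ← Ideal.smul_top_eq_map,
    AdicCompletion.pow_smul_top_eq_ker_eval (IsNoetherian.noetherian _), LinearMap.mem_ker,
    map_sub, sub_eq_zero, ← hr]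
  rfl

end ModuleClosure

/-! ### The main theorem -/

theorem mainTheorem11 {R : Type*} [CommRing R] [IsRegularLocalRing R]
    (hdim : ringKrullDim R = 2)
    {M : Type*} [AddCommGroup M] [Module R M] [Module.Finite R M] [Module.IsTorsionFree R M]
    (hM : ModuleClosure.IsIntegrallyClosed R M) :
    Module.Finite (AdicCompletion (IsLocalRing.maximalIdeal R) R)
        (AdicCompletion (IsLocalRing.maximalIdeal R) R ⊗[R] M) ∧
      Module.IsTorsionFree (AdicCompletion (IsLocalRing.maximalIdeal R) R)
        (AdicCompletion (IsLocalRing.maximalIdeal R) R ⊗[R] M) ∧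
      ModuleClosure.IsIntegrallyClosed (AdicCompletion (IsLocalRing.maximalIdeal R) R)
        (AdicCompletion (IsLocalRing.maximalIdeal R) R ⊗[R] M) := by
  have := ModuleClosure.isDomain_of_isRegularLocalRing_of_ringKrullDim_eq_two hdim
  obtain ⟨x, y, hx0, h⟩ := ModuleClosure.exists_isParameterPair hdim
  have := h.isDomain_adicCompletion hx0
  have h' := h.adicCompletion
  have := h'.isNoetherianRing
  refine ⟨inferInstance, inferInstance, Set.Subset.antisymm ?_ ?_⟩
  · exact fun v hv V _ _ => ModuleClosure.mem_extend_of_mem_range hv V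
  · intro v hv
    obtain ⟨k, hk⟩ := ModuleClosure.IsIntegralOver.exists_maximalIdeal_pow_smul_mem_range
      (fun P _ hP => h'.exists_eq_span_singleton P hP) hv
    have hne : IsLocalRing.maximalIdeal R ^ k ≠ ⊥ := by
      intro hbot
      have := hbot ▸ Ideal.pow_mem_pow h.x_mem k
      exact pow_ne_zero k hx0 (Ideal.mem_bot.mp this)
    obtain ⟨f, w, hw⟩ := ModuleClosure.exists_sub_genericMap_mem_range
      (AdicCompletion (IsLocalRing.maximalIdeal R) R) (IsLocalRing.maximalIdeal R ^ k) hne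
      (ModuleClosure.exists_sub_algebraMap_mem_map_pow k) (v := v) fun r hr => hk _ (by
        rw [AdicCompletion.maximalIdeal_eq_map, ← Ideal.map_pow]
        exact Ideal.mem_map_of_mem _ hr)
    -- In `M_K'`, `f` is `v` minus an element of `A ⊗ M`, so it is integral over `A ⊗ M`, and
    -- descent applies.
    have hf : ModuleClosure.IsIntegralOver f := by
      refine ModuleClosure.isIntegralOver_of_genericMap
        (AdicCompletion (IsLocalRing.maximalIdeal R) R) fun V hV hle => ?_
      rw [← sub_sub_cancel v (ModuleClosure.genericMap R _ M f), ← hw]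
      exact sub_mem (hv V hV hle) (ModuleClosure.mem_extend_of_mem_range ⟨w, rfl⟩ V)
    obtain ⟨m, rfl⟩ : f ∈ Set.range (ModuleClosure.toGeneric R M) := by
      rw [hM]; exact hf
    refine ⟨w + 1 ⊗ₜ m, ?_⟩
    rw [map_add, hw, ← ModuleClosure.genericMap_toGeneric, sub_add_cancel]
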